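/- Let $\mathcal D_k,\mathcal D_u$ be standard Borel spaces (Borel subsets of Polish function spaces), let $\mathcal D^s,\mathcal D^t\subseteq \mathcal D_k\times\mathcal D_u$ be measurable, and let $P^s,P^t$ be probability measures on $\mathcal D^s,\mathcal D^t$. Let $c:\mathcal D^s\times\mathcal D^t\to\mathbb R$ be a measurable cost, $\lambda\in\mathbb R$, and let $r:\mathcal D^t\to\mathbb R$ be measurable and $P^t$-integrable; $r(k,u)$ measures the violation of the physical relation by the pair $(k,u)$, for instance $r(k,u)=m(\mathcal G(k),u)$ with an operator $\mathcal G:\mathcal D_k\to\mathcal D_u$ and a metric $m$ on $\mathcal D_u$. For measurable $T:\mathcal D^s\to\mathcal D^t$ put $\mathcal R(T)=\int r(T(k,u))\,dP^s(k,u)$, and for measurable, $P^t$-integrable $f:\mathcal D^t\to\mathbb R$ put $$\mathcal L(T,f)=\int_{\mathcal D^s}\big[c((k,u),T(k,u))-f(T(k,u))+\lambda\, r(T(k,u))\big]\,dP^s+\int_{\mathcal D^t}f\,dP^t .$$ Integrals of real functions with respect to $P^s$ or a coupling are taken in $[-\infty,+\infty]$, with value $+\infty$ when the positive part has infinite integral.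 Let $$M(P^s,P^t)=\inf_{T_\#P^s=P^t}\int c(x,T(x))\,dP^s(x),\qquad K(P^s,P^t)=\inf_{\pi\in\Pi(P^s,P^t)}\int c\,d\pi ,$$ where $\Pi(P^s,P^t)$ is the set of measures on $\mathcal D^s\times\mathcal D^t$ with marginals $P^s$ and $P^t$; a Monge map is a minimizer in the first problem. Suppose the dual problem $\sup_f\inf_T\mathcal L(T,f)$ has a saddle point $(T^*,f^*)$, i.e. $\mathcal L(T^*,f^*)$ is finite and $\mathcal L(T^*,f)\le\mathcal L(T^*,f^*)\le\mathcal L(T,f^*)$ for all $f$ and $T$ as above. Then: 1. $\sup_f\inf_T\mathcal L(T,f)=\mathcal L(T^*,f^*)=K(P^s,P^t)+\lambda\,\mathcal R(T^*)$. 2. Suppose moreover that $T^*_\#P^s=P^t$ and that the target obeys the physical relation, i.e. $r=0$ $P^t$-almost everywhere. Then the dual problem reduces to the dual problem $\sup_f\inf_T\mathcal L_0(T,f)$ of the Monge problem, where $\mathcal L_0(T,f)=\int [c(x,T(x))-f(T(x))]\,dP^s(x)+\int f\,dP^t$, in the following sense: $\mathcal L(T,f)=\mathcal L_0(T,f)$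 for all $f$ whenever $T_\#P^s=P^t$, the two problems have the same value, and $(T^*,f_1)$ is a saddle point of the second for some $f_1$ that equals $f^*$ $P^t$-almost everywhere. Furthermore $T^*$ is a Monge map and $\mathcal L(T^*,f^*)=M(P^s,P^t)$. -/

import Mathlib

open MeasureTheory
open scoped ENNReal

noncomputable section

namespace POTT

open Classical in
/-- The integral of a real function as an extended real number: the integral of the positive part
minus the integral of the negative part, with value `+∞` when the positive part has infinite
integral.  (It is the Bochner integral for integrable `g`; in a minimisation problem the undefined
case `∞ - ∞` counts as `+∞`.) -/
def extIntegral {α : Type*} [MeasurableSpace α] (μ : Measure α) (g : α → ℝ) : EReal :=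
  if ∫⁻ a, ENNReal.ofReal (g a) ∂μ = ⊤ then ⊤
  else ((∫⁻ a, ENNReal.ofReal (g a) ∂μ : ℝ≥0∞) : EReal)
    - ((∫⁻ a, ENNReal.ofReal (-g a) ∂μ : ℝ≥0∞) : EReal)

section Transport

variable {X Y : Type*} [MeasurableSpace X] [MeasurableSpace Y]

/-- `T` is a transport map from `Ps` to `Pt`: `T_# Ps = Pt`. -/
def IsTransportMap (Ps : Measure X) (Pt : Measure Y) (T : X → Y) : Prop :=
  Measurable T ∧ Ps.map T = Pt

/-- `π` is a coupling: a joint distribution with marginals `Ps` and `Pt`. -/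
def IsCoupling (Ps : Measure X) (Pt : Measure Y) (π : Measure (X × Y)) : Prop :=
  π.map Prod.fst = Ps ∧ π.map Prod.snd = Pt

/-- Total cost `∫ c(x, T x) dPs` of the map `T`. -/
def mapCost (c : X → Y → ℝ) (Ps : Measure X) (T : X → Y) : EReal :=
  extIntegral Ps (fun x => c x (T x))

/-- Optimal value `M(Ps, Pt)` of the Monge problem. -/
def mongeValue (c : X → Y → ℝ) (Ps : Measure X) (Pt : Measure Y) : EReal :=
  ⨅ (T : X → Y) (_ : IsTransportMap Ps Pt T), mapCost c Ps T

/-- Optimal value `K(Ps, Pt)` of the Kantorovich problem. -/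
def kantorovichValue (c : X → Y → ℝ) (Ps : Measure X) (Pt : Measure Y) : EReal :=
  ⨅ (π : Measure (X × Y)) (_ : IsCoupling Ps Pt π), extIntegral π (fun p => c p.1 p.2)

/-- `T` is a Monge map: a transport map of least total cost. -/
def IsMongeMap (c : X → Y → ℝ) (Ps : Measure X) (Pt : Measure Y) (T : X → Y) : Prop :=
  IsTransportMap Ps Pt T ∧
    ∀ S : X → Y, IsTransportMap Ps Pt S → mapCost c Ps T ≤ mapCost c Ps S

/-- The physical regularization `R(T) = ∫ r(T x) dPs`, where `r y` measures how far the state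
`y = (k, u)` is from obeying the physical relation, e.g. `r (k, u) = m (G k) u` for an operator `G`
and a metric `m`. -/
def physReg (r : Y → ℝ) (Ps : Measure X) (T : X → Y) : EReal :=
  extIntegral Ps (fun x => r (T x))

/-- The admissible multipliers `f`: measurable and `Pt`-integrable functions. -/
def IsMultiplier (Pt : Measure Y) (f : Y → ℝ) : Prop :=
  Measurable f ∧ Integrable f Pt

/-- The objective
`L(T, f) = ∫ (c(x, T x) - f(T x) + lam * r(T x)) dPs + ∫ f dPt`. -/
def lagrangian (c : X → Y → ℝ) (r : Y → ℝ) (lam : ℝ) (Ps : Measure X) (Pt : Measure Y)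
    (T : X → Y) (f : Y → ℝ) : EReal :=
  extIntegral Ps (fun x => c x (T x) - f (T x) + lam * r (T x)) + ((∫ y, f y ∂Pt : ℝ) : EReal)

/-- The objective `∫ (c(x, T x) - f(T x)) dPs + ∫ f dPt` of the dual of the Monge problem. -/
def mongeLagrangian (c : X → Y → ℝ) (Ps : Measure X) (Pt : Measure Y)
    (T : X → Y) (f : Y → ℝ) : EReal :=
  extIntegral Ps (fun x => c x (T x) - f (T x)) + ((∫ y, f y ∂Pt : ℝ) : EReal)

/-- The value `sup_f inf_T L(T, f)` over all multipliers `f` and all measurable maps `T`. -/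
def dualValue (Pt : Measure Y) (L : (X → Y) → (Y → ℝ) → EReal) : EReal :=
  ⨆ (f : Y → ℝ) (_ : IsMultiplier Pt f), ⨅ (T : X → Y) (_ : Measurable T), L T f

/-- `(T₀, f₀)` is a saddle point, with finite value, of the problem `sup_f inf_T L(T, f)`. -/
structure IsSaddlePoint (Pt : Measure Y) (L : (X → Y) → (Y → ℝ) → EReal)
    (T₀ : X → Y) (f₀ : Y → ℝ) : Prop where
  measurable_map : Measurable T₀
  multiplier : IsMultiplier Pt f₀
  ne_top : L T₀ f₀ ≠ ⊤
  ne_bot : L T₀ f₀ ≠ ⊥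
  le_of_multiplier : ∀ f : Y → ℝ, IsMultiplier Pt f → L T₀ f ≤ L T₀ f₀
  le_of_map : ∀ T : X → Y, Measurable T → L T₀ f₀ ≤ L T f₀

end Transport

end POTT

end

namespace POTT

open ProbabilityTheory

/-! ### Extended integrals of real functions. -/

section ExtIntegral

variable {α β : Type*} [MeasurableSpace α] [MeasurableSpace β] {μ : Measure α} {g h : α → ℝ}

/-! Each half of the saddle inequality yields one half of optimality. Varying the multiplier by plus
and minus an indicator forces `T₀` to push `Ps` to `Pt` (`IsSaddlePoint.map_eq`). Varying the map
shows that `T₀ x` minimises `h x y = c x y - f₀ y + lam * r y`, not for every `y`, but almost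
everywhere along any coupling (`ae_le_of_forall_extIntegral_le`). Integrating this inequality
against a coupling, the terms in `f₀` and `r` depend on the marginals only and cancel, so no
coupling is cheaper than `T₀`. Hence the Kantorovich value is the cost of `T₀`, and `T₀` is a Monge
map.

For the reduction to the Monge dual, `f ↦ f - lam * r` is a bijection of the multipliers that
absorbs the penalty; it leaves `∫ f dPt` unchanged when `r` vanishes `Pt`-almost everywhere. -/

theorem extIntegral_of_integrable (hg : Integrable g μ) :
    extIntegral μ g = ((∫ a, g a ∂μ : ℝ) : EReal) := by
  have hp : ∫⁻ a, ENNReal.ofReal (g a) ∂μ ≠ ⊤ := hg.lintegral_lt_top.ne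
  have hn : ∫⁻ a, ENNReal.ofReal (-g a) ∂μ ≠ ⊤ := hg.neg.lintegral_lt_top.ne
  rw [extIntegral, if_neg hp, integral_eq_lintegral_pos_part_sub_lintegral_neg_part hg,
    EReal.coe_sub, EReal.coe_ennreal_toReal hp, EReal.coe_ennreal_toReal hn]

theorem extIntegral_congr_ae (hgh : g =ᵐ[μ] h) : extIntegral μ g = extIntegral μ h := by
  have hp : ∫⁻ a, ENNReal.ofReal (g a) ∂μ = ∫⁻ a, ENNReal.ofReal (h a) ∂μ :=
    lintegral_congr_ae (hgh.mono fun a ha => by simp only [ha])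
  have hn : ∫⁻ a, ENNReal.ofReal (-g a) ∂μ = ∫⁻ a, ENNReal.ofReal (-h a) ∂μ :=
    lintegral_congr_ae (hgh.mono fun a ha => by simp only [ha])
  rw [extIntegral, extIntegral, hp, hn]

/-- Reading `∞ - ∞` as `+∞` is what makes this hold without integrability: the only problematic case
has `⊤` on the right. -/
theorem extIntegral_mono_ae (hgh : g ≤ᵐ[μ] h) : extIntegral μ g ≤ extIntegral μ h := by
  have hp : ∫⁻ a, ENNReal.ofReal (g a) ∂μ ≤ ∫⁻ a, ENNReal.ofReal (h a) ∂μ :=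
    lintegral_mono_ae (hgh.mono fun a ha => ENNReal.ofReal_le_ofReal ha)
  have hn : ∫⁻ a, ENNReal.ofReal (-h a) ∂μ ≤ ∫⁻ a, ENNReal.ofReal (-g a) ∂μ :=
    lintegral_mono_ae (hgh.mono fun a ha => ENNReal.ofReal_le_ofReal (neg_le_neg ha))
  unfold extIntegral
  by_cases hh : ∫⁻ a, ENNReal.ofReal (h a) ∂μ = ⊤
  · rw [if_pos hh]
    exact le_top
  · rw [if_neg hh, if_neg (ne_top_of_le_ne_top hh hp)]
    exact EReal.sub_le_sub (EReal.coe_ennreal_le_coe_ennreal_iff.2 hp)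
      (EReal.coe_ennreal_le_coe_ennreal_iff.2 hn)

theorem integrable_of_extIntegral (hg : Measurable g) (h_top : extIntegral μ g ≠ ⊤)
    (h_bot : extIntegral μ g ≠ ⊥) : Integrable g μ := by
  have hp : ∫⁻ a, ENNReal.ofReal (g a) ∂μ ≠ ⊤ := fun hp => h_top (by rw [extIntegral, if_pos hp])
  have hn : ∫⁻ a, ENNReal.ofReal (-g a) ∂μ ≠ ⊤ := fun hn => h_bot (by
    rw [extIntegral, if_neg hp, hn, EReal.coe_ennreal_top, EReal.sub_top])
  have ip := integrable_toReal_of_lintegral_ne_top hg.ennreal_ofReal.aemeasurable hp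
  have im := integrable_toReal_of_lintegral_ne_top hg.neg.ennreal_ofReal.aemeasurable hn
  refine (ip.sub im).congr (Filter.Eventually.of_forall fun a => ?_)
  rcases le_total 0 (g a) with h0 | h0 <;> simp [ENNReal.toReal_ofReal', h0]

theorem extIntegral_map {F : α → β} (hF : Measurable F) {k : β → ℝ} (hk : Measurable k) :
    extIntegral (μ.map F) k = extIntegral μ (fun a => k (F a)) := by
  rw [extIntegral, extIntegral, lintegral_map hk.ennreal_ofReal hF,
    lintegral_map (f := fun b => ENNReal.ofReal (-k b)) hk.neg.ennreal_ofReal hF]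

/-- Integrability of `g` comes for free, since its integral is squeezed to the finite integral of
`h`. -/
theorem ae_eq_of_le_of_extIntegral_le (hg : Measurable g) (hh : Integrable h μ)
    (hgh : ∀ a, g a ≤ h a) (hle : extIntegral μ h ≤ extIntegral μ g) : g =ᵐ[μ] h := by
  have hle' := extIntegral_mono_ae (μ := μ) (Filter.Eventually.of_forall hgh)
  rw [extIntegral_of_integrable hh] at hle hle'
  have hgi : Integrable g μ := integrable_of_extIntegral hg
    (ne_top_of_le_ne_top (EReal.coe_ne_top _) hle') (ne_bot_of_le_ne_bot (EReal.coe_ne_bot _) hle)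
  rw [extIntegral_of_integrable hgi] at hle hle'
  exact (integral_eq_iff_of_ae_le hgi hh (Filter.Eventually.of_forall hgh)).1
    (le_antisymm (EReal.coe_le_coe_iff.1 hle') (EReal.coe_le_coe_iff.1 hle))

end ExtIntegral

section Transport

variable {X Y : Type*} [MeasurableSpace X] [MeasurableSpace Y]
  {Ps : Measure X} {Pt : Measure Y}
  {c : X → Y → ℝ} {r : Y → ℝ} {lam : ℝ} {T₀ : X → Y} {f₀ : Y → ℝ}

/-! ### From minimality among maps to minimality along couplings. -/

/-- A measurable set charged by a coupling is charged by the graph of a measurable map. -/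
theorem measure_eq_zero_of_forall_map [StandardBorelSpace Y] [Nonempty Y]
    {π : Measure (X × Y)} [IsFiniteMeasure π] {A : Set (X × Y)} (hA : MeasurableSet A)
    (h : ∀ T : X → Y, Measurable T → π.fst {x | (x, T x) ∈ A} = 0) : π A = 0 := by
  -- Randomisation replaces measurable selection: `π` is the law of `(x, θ x u)` with `u` uniform
  -- and independent of `x`. For each fixed `u` the map `θ · u` is measurable, so Fubini applies.
  obtain ⟨θ, hθ, hκ⟩ := π.condKernel.exists_measurable_map_eq_unitInterval
  have hθ' : Measurable fun p : X × unitInterval => (p.1, θ p.1 p.2) := measurable_fst.prodMk hθ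
  have hB : MeasurableSet {p : X × unitInterval | (p.1, θ p.1 p.2) ∈ A} := hθ' hA
  have hprod : (π.fst.prod (volume : Measure unitInterval))
      {p : X × unitInterval | (p.1, θ p.1 p.2) ∈ A} = 0 := by
    rw [Measure.prod_apply_symm hB]
    refine (lintegral_congr fun u => ?_).trans lintegral_zero
    exact h (fun x => θ x u) (hθ.comp measurable_prodMk_right)
  rw [← π.disintegrate π.condKernel, Measure.compProd_apply hA, ← hprod, Measure.prod_apply hB]
  refine lintegral_congr fun x => ?_
  rw [← hκ x, Measure.map_apply hθ.of_uncurry_left (measurable_prodMk_left hA)]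
  rfl

/-- A map minimising an integral cost minimises the cost pointwise along every coupling. -/
theorem ae_le_of_forall_extIntegral_le [StandardBorelSpace Y] [Nonempty Y]
    [IsProbabilityMeasure Ps]
    {h : X → Y → ℝ} (hh : Measurable (Function.uncurry h)) (hT₀ : Measurable T₀)
    (hint : Integrable (fun x => h x (T₀ x)) Ps)
    (hmin : ∀ T : X → Y, Measurable T →
      extIntegral Ps (fun x => h x (T₀ x)) ≤ extIntegral Ps (fun x => h x (T x)))
    {π : Measure (X × Y)} (hπ : π.map Prod.fst = Ps) :
    ∀ᵐ p ∂π, h p.1 (T₀ p.1) ≤ h p.1 p.2 := by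
  have : IsProbabilityMeasure (π.map Prod.fst) := by
    rw [hπ]
    infer_instance
  have : IsProbabilityMeasure π := Measure.isProbabilityMeasure_of_map Prod.fst
  have hcomp : ∀ T : X → Y, Measurable T → Measurable fun x => h x (T x) := fun T hT =>
    hh.comp (measurable_id.prodMk hT)
  have hA : MeasurableSet {p : X × Y | h p.1 p.2 < h p.1 (T₀ p.1)} :=
    measurableSet_lt hh ((hcomp T₀ hT₀).comp measurable_fst)
  suffices hzero : π {p : X × Y | h p.1 p.2 < h p.1 (T₀ p.1)} = 0 by
    rw [ae_iff]
    simpa only [not_le] using hzero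
  refine measure_eq_zero_of_forall_map hA fun T hT => ?_
  rw [Measure.fst, hπ]
  classical
  have hS : MeasurableSet {x | h x (T x) < h x (T₀ x)} :=
    measurableSet_lt (hcomp T hT) (hcomp T₀ hT₀)
  -- Switching to `T` exactly where it is strictly better gives a competitor; minimality of `T₀`
  -- makes the switching set null.
  set T' : X → Y := fun x => if h x (T x) < h x (T₀ x) then T x else T₀ x with hT'
  have hT'm : Measurable T' := Measurable.ite hS hT hT₀
  have hle : ∀ x, h x (T' x) ≤ h x (T₀ x) := fun x => by
    by_cases hx : h x (T x) < h x (T₀ x)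
    · simp only [hT', if_pos hx]
      exact hx.le
    · simp only [hT', if_neg hx, le_refl]
  have heq := ae_eq_of_le_of_extIntegral_le (hcomp T' hT'm) hint hle (hmin T' hT'm)
  refine measure_mono_null (fun x hx => ?_) (ae_iff.1 heq)
  have hx' : h x (T x) < h x (T₀ x) := hx
  simp only [Set.mem_ofPred_eq, hT', if_pos hx']
  exact hx'.ne

/-! ### Consequences of the saddle inequalities. -/

theorem IsSaddlePoint.dualValue_eq {L : (X → Y) → (Y → ℝ) → EReal}
    (hs : IsSaddlePoint Pt L T₀ f₀) : dualValue Pt L = L T₀ f₀ := by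
  refine le_antisymm (iSup₂_le fun f hf => ?_) ?_
  · exact (iInf₂_le T₀ hs.measurable_map).trans (hs.le_of_multiplier f hf)
  · exact le_trans (le_iInf₂ hs.le_of_map)
      (le_iSup₂ (f := fun (f : Y → ℝ) (_ : IsMultiplier Pt f) =>
        ⨅ (T : X → Y) (_ : Measurable T), L T f) f₀ hs.multiplier)

theorem measurable_integrand (hc : Measurable (Function.uncurry c)) (hr : Measurable r)
    {f : Y → ℝ} (hf : Measurable f) :
    Measurable (Function.uncurry fun x y => c x y - f y + lam * r y) :=
  (hc.sub (hf.comp measurable_snd)).add ((hr.comp measurable_snd).const_mul lam)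

theorem IsSaddlePoint.integrable_integrand (hc : Measurable (Function.uncurry c))
    (hr : Measurable r) (hs : IsSaddlePoint Pt (lagrangian c r lam Ps Pt) T₀ f₀) :
    Integrable (fun x => c x (T₀ x) - f₀ (T₀ x) + lam * r (T₀ x)) Ps := by
  refine integrable_of_extIntegral ((measurable_integrand hc hr hs.multiplier.1).comp
    (measurable_id.prodMk hs.measurable_map)) (fun h => hs.ne_top ?_) (fun h => hs.ne_bot ?_)
  · rw [lagrangian, h, EReal.top_add_coe]
  · rw [lagrangian, h, EReal.bot_add]

theorem IsSaddlePoint.lagrangian_eq (hc : Measurable (Function.uncurry c))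
    (hr : Measurable r) (hs : IsSaddlePoint Pt (lagrangian c r lam Ps Pt) T₀ f₀) :
    lagrangian c r lam Ps Pt T₀ f₀ =
      ((∫ x, (c x (T₀ x) - f₀ (T₀ x) + lam * r (T₀ x)) ∂Ps + ∫ y, f₀ y ∂Pt : ℝ) : EReal) := by
  rw [lagrangian, extIntegral_of_integrable (hs.integrable_integrand hc hr), ← EReal.coe_add]

/-- First variation in the multiplier, with competitor `f₀ + g`. Integrability along `T₀` is assumed
separately because the pushforward is not yet known. -/
theorem IsSaddlePoint.integral_le_integral (hc : Measurable (Function.uncurry c))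
    (hr : Measurable r) (hs : IsSaddlePoint Pt (lagrangian c r lam Ps Pt) T₀ f₀)
    {g : Y → ℝ} (hg : Measurable g) (hgt : Integrable g Pt)
    (hgs : Integrable (fun x => g (T₀ x)) Ps) :
    ∫ y, g y ∂Pt ≤ ∫ x, g (T₀ x) ∂Ps := by
  have hint := hs.integrable_integrand hc hr
  have key := hs.le_of_multiplier (fun y => f₀ y + g y)
    ⟨hs.multiplier.1.add hg, hs.multiplier.2.add hgt⟩
  rw [hs.lagrangian_eq hc hr, lagrangian] at key
  have heq : (fun x => c x (T₀ x) - (f₀ (T₀ x) + g (T₀ x)) + lam * r (T₀ x))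
      = fun x => (c x (T₀ x) - f₀ (T₀ x) + lam * r (T₀ x)) - g (T₀ x) := by
    funext x
    ring
  have hsub : Integrable (fun x => c x (T₀ x) - f₀ (T₀ x) + lam * r (T₀ x) - g (T₀ x)) Ps :=
    hint.sub hgs
  rw [heq, extIntegral_of_integrable hsub, integral_sub hint hgs,
    integral_add hs.multiplier.2 hgt, ← EReal.coe_add, EReal.coe_le_coe_iff] at key
  linarith

theorem IsSaddlePoint.map_eq [IsProbabilityMeasure Ps] [IsProbabilityMeasure Pt]
    (hc : Measurable (Function.uncurry c))
    (hr : Measurable r) (hs : IsSaddlePoint Pt (lagrangian c r lam Ps Pt) T₀ f₀) :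
    Ps.map T₀ = Pt := by
  have hT₀ := hs.measurable_map
  ext S hS
  have hm : Measurable (S.indicator fun _ => (1 : ℝ)) := measurable_const.indicator hS
  have hit : Integrable (S.indicator fun _ => (1 : ℝ)) Pt := (integrable_const 1).indicator hS
  have hcomp : (fun x => S.indicator (fun _ => (1 : ℝ)) (T₀ x))
      = (T₀ ⁻¹' S).indicator fun _ => (1 : ℝ) := rfl
  have his : Integrable (fun x => S.indicator (fun _ => (1 : ℝ)) (T₀ x)) Ps := by
    rw [hcomp]
    exact (integrable_const 1).indicator (hT₀ hS)
  have h1 := hs.integral_le_integral hc hr hm hit his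
  have h2 := hs.integral_le_integral hc hr hm.neg hit.neg his.neg
  simp only [Pi.neg_apply, integral_neg, neg_le_neg_iff] at h2
  have h3 := le_antisymm h2 h1
  rw [hcomp, integral_indicator_const _ (hT₀ hS), integral_indicator_const _ hS, smul_eq_mul,
    smul_eq_mul, mul_one, mul_one] at h3
  rw [Measure.map_apply hT₀ hS]
  exact (measureReal_eq_measureReal_iff).1 h3

/-! ### Optimality of the saddle map among couplings. -/

theorem IsTransportMap.isCoupling {T : X → Y} (hT : IsTransportMap Ps Pt T) :
    IsCoupling Ps Pt (Ps.map fun x => (x, T x)) := by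
  have hm : Measurable fun x => (x, T x) := measurable_id.prodMk hT.1
  refine ⟨?_, ?_⟩
  · rw [Measure.map_map measurable_fst hm]
    exact Measure.map_id
  · rw [Measure.map_map measurable_snd hm]
    exact hT.2

theorem kantorovichValue_le_mapCost (hc : Measurable (Function.uncurry c)) {T : X → Y}
    (hT : IsTransportMap Ps Pt T) : kantorovichValue c Ps Pt ≤ mapCost c Ps T := by
  refine (iInf₂_le _ hT.isCoupling).trans (le_of_eq ?_)
  exact extIntegral_map (measurable_id.prodMk hT.1) hc

theorem integrable_comp_of_map_eq {α β : Type*} [MeasurableSpace α] [MeasurableSpace β]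
    {μ : Measure α} {ν : Measure β} {F : α → β} (hF : Measurable F) (hmap : μ.map F = ν)
    {g : β → ℝ} (hg : Integrable g ν) : Integrable (fun a => g (F a)) μ := by
  subst hmap
  exact hg.comp_measurable hF

theorem integral_comp_of_map_eq {α β : Type*} [MeasurableSpace α] [MeasurableSpace β]
    {μ : Measure α} {ν : Measure β} {F : α → β} (hF : Measurable F) (hmap : μ.map F = ν)
    {g : β → ℝ} (hg : Measurable g) : ∫ a, g (F a) ∂μ = ∫ b, g b ∂ν := by
  subst hmap
  exact (integral_map hF.aemeasurable hg.aestronglyMeasurable).symm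

theorem IsSaddlePoint.integrable_cost [IsProbabilityMeasure Ps] [IsProbabilityMeasure Pt]
    (hc : Measurable (Function.uncurry c))
    (hr : Measurable r) (hrt : Integrable r Pt)
    (hs : IsSaddlePoint Pt (lagrangian c r lam Ps Pt) T₀ f₀) :
    Integrable (fun x => c x (T₀ x)) Ps := by
  have hmap := hs.map_eq hc hr
  have hfi := integrable_comp_of_map_eq hs.measurable_map hmap hs.multiplier.2
  have hri := integrable_comp_of_map_eq hs.measurable_map hmap hrt
  refine (((hs.integrable_integrand hc hr).add hfi).sub (hri.const_mul lam)).congr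
    (Filter.Eventually.of_forall fun x => ?_)
  simp only [Pi.add_apply, Pi.sub_apply]
  ring

theorem IsSaddlePoint.integral_integrand [IsProbabilityMeasure Ps] [IsProbabilityMeasure Pt]
    (hc : Measurable (Function.uncurry c))
    (hr : Measurable r) (hrt : Integrable r Pt)
    (hs : IsSaddlePoint Pt (lagrangian c r lam Ps Pt) T₀ f₀) :
    ∫ x, (c x (T₀ x) - f₀ (T₀ x) + lam * r (T₀ x)) ∂Ps
      = ∫ x, c x (T₀ x) ∂Ps - ∫ y, f₀ y ∂Pt + lam * ∫ y, r y ∂Pt := by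
  have hmap := hs.map_eq hc hr
  have hfi := integrable_comp_of_map_eq hs.measurable_map hmap hs.multiplier.2
  have hri := integrable_comp_of_map_eq hs.measurable_map hmap hrt
  have hci := hs.integrable_cost hc hr hrt
  have hsub : Integrable (fun x => c x (T₀ x) - f₀ (T₀ x)) Ps := hci.sub hfi
  rw [integral_add hsub (hri.const_mul lam), integral_sub hci hfi, integral_const_mul,
    integral_comp_of_map_eq hs.measurable_map hmap hs.multiplier.1,
    integral_comp_of_map_eq hs.measurable_map hmap hr]

theorem IsSaddlePoint.mapCost_le_extIntegral [StandardBorelSpace Y]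
    [IsProbabilityMeasure Ps] [IsProbabilityMeasure Pt]
    (hc : Measurable (Function.uncurry c)) (hr : Measurable r) (hrt : Integrable r Pt)
    (hs : IsSaddlePoint Pt (lagrangian c r lam Ps Pt) T₀ f₀)
    {π : Measure (X × Y)} (hπ : IsCoupling Ps Pt π) :
    mapCost c Ps T₀ ≤ extIntegral π (fun p => c p.1 p.2) := by
  have : Nonempty Y := nonempty_of_isProbabilityMeasure Pt
  have hT₀ := hs.measurable_map
  have hint := hs.integrable_integrand hc hr
  have hm := measurable_integrand (lam := lam) hc hr hs.multiplier.1
  have hmin : ∀ T : X → Y, Measurable T →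
      extIntegral Ps (fun x => c x (T₀ x) - f₀ (T₀ x) + lam * r (T₀ x))
        ≤ extIntegral Ps (fun x => c x (T x) - f₀ (T x) + lam * r (T x)) := fun T hT =>
    -- The common term `∫ f₀ dPt` is real, so it cancels in `EReal`.
    (EReal.addLECancellable_coe _).add_le_add_iff_right.1 (hs.le_of_map T hT)
  have hae := ae_le_of_forall_extIntegral_le hm hT₀ hint hmin hπ.1
  have hvi := integrable_comp_of_map_eq measurable_fst hπ.1 hint
  have hfi := integrable_comp_of_map_eq measurable_snd hπ.2 hs.multiplier.2
  have hri := integrable_comp_of_map_eq measurable_snd hπ.2 hrt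
  -- Pointwise minimality solved for `c`. The lower bound is a function of `p.1` plus a function of
  -- `p.2`, so its integral is fixed by the marginals.
  have hle : extIntegral π (fun p => (c p.1 (T₀ p.1) - f₀ (T₀ p.1) + lam * r (T₀ p.1))
      + f₀ p.2 - lam * r p.2) ≤ extIntegral π (fun p => c p.1 p.2) :=
    extIntegral_mono_ae (hae.mono fun p hp => by linarith)
  refine le_trans (le_of_eq ?_) hle
  have hadd : Integrable
      (fun p => c p.1 (T₀ p.1) - f₀ (T₀ p.1) + lam * r (T₀ p.1) + f₀ p.2) π := hvi.add hfi
  have hsub : Integrable (fun p => c p.1 (T₀ p.1) - f₀ (T₀ p.1) + lam * r (T₀ p.1)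
      + f₀ p.2 - lam * r p.2) π := hadd.sub (hri.const_mul lam)
  rw [mapCost, extIntegral_of_integrable (hs.integrable_cost hc hr hrt),
    extIntegral_of_integrable hsub,
    integral_sub hadd (hri.const_mul lam), integral_add hvi hfi, integral_const_mul,
    integral_comp_of_map_eq measurable_snd hπ.2 hs.multiplier.1,
    integral_comp_of_map_eq measurable_snd hπ.2 hr,
    integral_comp_of_map_eq measurable_fst hπ.1
      (g := fun x => c x (T₀ x) - f₀ (T₀ x) + lam * r (T₀ x))
      (hm.comp (measurable_id.prodMk hT₀)),
    hs.integral_integrand hc hr hrt]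
  congr 1
  ring

theorem IsSaddlePoint.kantorovichValue_eq [StandardBorelSpace Y]
    [IsProbabilityMeasure Ps] [IsProbabilityMeasure Pt]
    (hc : Measurable (Function.uncurry c)) (hr : Measurable r) (hrt : Integrable r Pt)
    (hs : IsSaddlePoint Pt (lagrangian c r lam Ps Pt) T₀ f₀) :
    kantorovichValue c Ps Pt = mapCost c Ps T₀ :=
  le_antisymm (kantorovichValue_le_mapCost hc ⟨hs.measurable_map, hs.map_eq hc hr⟩)
    (le_iInf₂ fun _ hπ => hs.mapCost_le_extIntegral hc hr hrt hπ)

theorem IsSaddlePoint.lagrangian_eq_mapCost_add [IsProbabilityMeasure Ps] [IsProbabilityMeasure Pt]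
    (hc : Measurable (Function.uncurry c))
    (hr : Measurable r) (hrt : Integrable r Pt)
    (hs : IsSaddlePoint Pt (lagrangian c r lam Ps Pt) T₀ f₀) :
    lagrangian c r lam Ps Pt T₀ f₀ = mapCost c Ps T₀ + (lam : EReal) * physReg r Ps T₀ := by
  have hmap := hs.map_eq hc hr
  have hri := integrable_comp_of_map_eq hs.measurable_map hmap hrt
  rw [hs.lagrangian_eq hc hr, hs.integral_integrand hc hr hrt, mapCost, physReg,
    extIntegral_of_integrable (hs.integrable_cost hc hr hrt), extIntegral_of_integrable hri,
    integral_comp_of_map_eq hs.measurable_map hmap hr, ← EReal.coe_mul, ← EReal.coe_add]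
  congr 1
  ring

theorem IsSaddlePoint.isMongeMap [StandardBorelSpace Y]
    [IsProbabilityMeasure Ps] [IsProbabilityMeasure Pt]
    (hc : Measurable (Function.uncurry c)) (hr : Measurable r) (hrt : Integrable r Pt)
    (hs : IsSaddlePoint Pt (lagrangian c r lam Ps Pt) T₀ f₀) : IsMongeMap c Ps Pt T₀ :=
  ⟨⟨hs.measurable_map, hs.map_eq hc hr⟩, fun _ hS =>
    (hs.kantorovichValue_eq hc hr hrt).symm.trans_le (kantorovichValue_le_mapCost hc hS)⟩

theorem IsMongeMap.mapCost_eq (h : IsMongeMap c Ps Pt T₀) :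
    mapCost c Ps T₀ = mongeValue c Ps Pt :=
  le_antisymm (le_iInf₂ h.2) (iInf₂_le T₀ h.1)

/-! ### Reduction to the Monge dual. -/

theorem lagrangian_eq_mongeLagrangian {T : X → Y} (hT : IsTransportMap Ps Pt T)
    (hr0 : ∀ᵐ y ∂Pt, r y = 0) (f : Y → ℝ) :
    lagrangian c r lam Ps Pt T f = mongeLagrangian c Ps Pt T f := by
  have h0 : ∀ᵐ x ∂Ps, r (T x) = 0 := ae_of_ae_map hT.1.aemeasurable (by rwa [hT.2])
  rw [lagrangian, mongeLagrangian]
  congr 1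
  exact extIntegral_congr_ae (h0.mono fun x hx => by simp only [hx, mul_zero, add_zero])

/-- Valid for every `T`, even one that moves mass to where `r ≠ 0`: the integrands agree
identically, and `hr0` is needed only for `∫ f dPt`. -/
theorem mongeLagrangian_sub (hr0 : ∀ᵐ y ∂Pt, r y = 0) (T : X → Y) (f : Y → ℝ) :
    mongeLagrangian c Ps Pt T (fun y => f y - lam * r y) = lagrangian c r lam Ps Pt T f := by
  rw [lagrangian, mongeLagrangian,
    integral_congr_ae (hr0.mono fun y hy => by simp only [hy, mul_zero, sub_zero] :
      (fun y => f y - lam * r y) =ᵐ[Pt] f)]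
  congr 2
  funext x
  ring

theorem IsSaddlePoint.mongeLagrangian_sub (hr : Measurable r) (hrt : Integrable r Pt)
    (hr0 : ∀ᵐ y ∂Pt, r y = 0) (hs : IsSaddlePoint Pt (lagrangian c r lam Ps Pt) T₀ f₀) :
    IsSaddlePoint Pt (mongeLagrangian c Ps Pt) T₀ (fun y => f₀ y - lam * r y) := by
  have key := POTT.mongeLagrangian_sub (c := c) (lam := lam) (Ps := Ps) hr0
  refine ⟨hs.measurable_map, ⟨hs.multiplier.1.sub (hr.const_mul lam),
    hs.multiplier.2.sub (hrt.const_mul lam)⟩, ?_, ?_, fun f hf => ?_, fun T hT => ?_⟩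
  · rw [key]
    exact hs.ne_top
  · rw [key]
    exact hs.ne_bot
  -- The inverse shift turns a multiplier of the Monge dual into one of the original problem.
  · have h := hs.le_of_multiplier (fun y => f y + lam * r y)
      ⟨hf.1.add (hr.const_mul lam), hf.2.add (hrt.const_mul lam)⟩
    rw [← key, ← key] at h
    simpa only [add_sub_cancel_right] using h
  · rw [key, key]
    exact hs.le_of_map T hT

end Transport

end POTT

theorem theorem1 {Dk Du : Type*}
    [MeasurableSpace Dk] [StandardBorelSpace Dk] [MeasurableSpace Du] [StandardBorelSpace Du]
    (Ds Dt : Set (Dk × Du)) (hDs : MeasurableSet Ds) (hDt : MeasurableSet Dt)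
    (Ps : Measure Ds) [IsProbabilityMeasure Ps] (Pt : Measure Dt) [IsProbabilityMeasure Pt]
    (c : Ds → Dt → ℝ) (hc : Measurable (Function.uncurry c))
    (r : Dt → ℝ) (hr : Measurable r) (hrt : Integrable r Pt)
    (lam : ℝ)
    (T₀ : Ds → Dt) (f₀ : Dt → ℝ)
    (hsaddle : POTT.IsSaddlePoint Pt (POTT.lagrangian c r lam Ps Pt) T₀ f₀) :
    (POTT.dualValue Pt (POTT.lagrangian c r lam Ps Pt) = POTT.lagrangian c r lam Ps Pt T₀ f₀ ∧
      POTT.lagrangian c r lam Ps Pt T₀ f₀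
        = POTT.kantorovichValue c Ps Pt + (lam : EReal) * POTT.physReg r Ps T₀) ∧
    (Ps.map T₀ = Pt → (∀ᵐ y ∂Pt, r y = 0) →
      (∀ T : Ds → Dt, POTT.IsTransportMap Ps Pt T → ∀ f : Dt → ℝ, POTT.IsMultiplier Pt f →
        POTT.lagrangian c r lam Ps Pt T f = POTT.mongeLagrangian c Ps Pt T f) ∧
      POTT.dualValue Pt (POTT.lagrangian c r lam Ps Pt)
        = POTT.dualValue Pt (POTT.mongeLagrangian c Ps Pt) ∧
      (∃ f₁ : Dt → ℝ, f₁ =ᵐ[Pt] f₀ ∧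
        POTT.IsSaddlePoint Pt (POTT.mongeLagrangian c Ps Pt) T₀ f₁) ∧
      POTT.IsMongeMap c Ps Pt T₀ ∧
      POTT.lagrangian c r lam Ps Pt T₀ f₀ = POTT.mongeValue c Ps Pt) := by
  have : StandardBorelSpace Dt := hDt.standardBorel
  have hK := hsaddle.kantorovichValue_eq hc hr hrt
  have hL := hsaddle.lagrangian_eq_mapCost_add hc hr hrt
  refine ⟨⟨hsaddle.dualValue_eq, by rw [hK, hL]⟩, fun hmap hr0 => ?_⟩
  have hs₁ := hsaddle.mongeLagrangian_sub hr hrt hr0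
  have hM := hsaddle.isMongeMap hc hr hrt
  refine ⟨fun T hT f _ => POTT.lagrangian_eq_mongeLagrangian hT hr0 f, ?_, ⟨_, ?_, hs₁⟩, hM, ?_⟩
  · rw [hsaddle.dualValue_eq, hs₁.dualValue_eq, POTT.mongeLagrangian_sub hr0]
  · exact hr0.mono fun y hy => by simp only [hy, mul_zero, sub_zero]
  · have hR : POTT.physReg r Ps T₀ = 0 := by
      have h0 : (fun x => r (T₀ x)) =ᵐ[Ps] fun _ => (0 : ℝ) :=
        ae_of_ae_map (p := fun y => r y = 0) hsaddle.measurable_map.aemeasurable (by rwa [hmap])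
      rw [POTT.physReg, POTT.extIntegral_congr_ae h0,
        POTT.extIntegral_of_integrable (integrable_const 0), integral_zero, EReal.coe_zero]
    rw [hL, hR, mul_zero, add_zero, hM.mapCost_eq]
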